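/- Let $n,d$ be positive integers. Let $\mathbb{N}^{n+1}_d$ be the set of multi-indices $\alpha\in\mathbb{N}^{n+1}$ with $|\alpha|=d$, and for $z\in\mathbb{R}^n$ let $m_d(z)=(\tilde z^{\alpha})_{\alpha\in\mathbb{N}^{n+1}_d}\in\mathbb{R}^{\binom{n+d}{d}}$ with $\tilde z=(1,z)$, i.e. the vector of all monomials of degree at most $d$ in $z$, indexed by their homogenizations. Let $\Sigma$ be the pseudo-moment cone in matrix form: the set of all real symmetric positive semidefinite matrices $X$ indexed by $\mathbb{N}^{n+1}_d\times\mathbb{N}^{n+1}_d$ that are generalized Hankel matrices, i.e. $X_{\alpha,\beta}=X_{\alpha',\beta'}$ whenever $\alpha+\beta=\alpha'+\beta'$. For a convex set $C$ and $x\in C$, let $\mathrm{minface}(x,C)$ be the smallest face of $C$ containing $x$. (1) Let $s$ be a positive integer with $$ s\le b(n,d):=\frac12\left(\binom{n+d}{d}+1\right)-\binom{n+d}{d}^{-1}\binom{n+2d}{2d}. $$ Then for generic $((w_i,z_i))_{i=1}^s\in(\mathbb{R}\times\mathbb{R}^n)^s$ (that is, for all points of some Zariski-open dense subset), $$ \mathrm{minface}\left(\sum_{i=1}^s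 w_i^2\,m_d(z_i)m_d(z_i)^{\mathsf T},\ \Sigma\right)=\mathrm{cone}\left(\{m_d(z_i)m_d(z_i)^{\mathsf T}\}_{i=1}^s\right), $$ where $\mathrm{cone}$ denotes the conic hull, and the matrices $m_d(z_1)m_d(z_1)^{\mathsf T},\dots,m_d(z_s)m_d(z_s)^{\mathsf T}$ are linearly independent. (2) For every fixed $d\ge 2$, $b(n,d)=\Theta(n^d)$ as $n\to\infty$. -/

import Mathlib

noncomputable section

namespace PseudoMoment

/-! ### Multi-indices, monomial vectors and generalized Hankel matrices -/

/-- Multi-indices `α ∈ ℕ^m` with `|α| = d`. -/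
abbrev MultiIndex (m d : ℕ) : Type := {α : Fin m →₀ ℕ // α.degree = d}

instance (m d : ℕ) : Fintype (MultiIndex m d) :=
  Fintype.subtype (Finset.univ.finsuppAntidiag d) (fun α => by
    simp [Finset.mem_finsuppAntidiag, Finsupp.degree_eq_sum])

/-- `v_d(u) = (u^α)_{|α| = d}`, the vector of all monomials of degree `d` in `m` variables. -/
def monomialVec {m : ℕ} (d : ℕ) (u : Fin m → ℝ) : MultiIndex m d → ℝ :=
  fun α => ∏ i, u i ^ α.1 i

/-- `m_d(z) = v_d([1; z])`, the vector of all monomials of degree at most `d` in `n` variables,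
where a monomial of degree at most `d` is indexed by its homogenization, a multi-index in
`ℕ^(n+1)` with sum `d` whose entry `0` is the exponent of the homogenizing variable. -/
def momentVec {n : ℕ} (d : ℕ) (z : Fin n → ℝ) : MultiIndex (n + 1) d → ℝ :=
  monomialVec d (Fin.cons 1 z : Fin (n + 1) → ℝ)

/-- The rank-one matrix `m_d(z) m_d(z)ᵀ`. -/
def atomMatrix {n : ℕ} (d : ℕ) (z : Fin n → ℝ) :
    Matrix (MultiIndex (n + 1) d) (MultiIndex (n + 1) d) ℝ :=
  Matrix.vecMulVec (momentVec d z) (momentVec d z)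

/-- Generalized multivariate Hankel matrices: the symmetric matrices whose entry at `(α, β)`
depends only on `α + β`. -/
def hankel (m d : ℕ) : Set (Matrix (MultiIndex m d) (MultiIndex m d) ℝ) :=
  {X | X.IsSymm ∧ ∀ α β α' β' : MultiIndex m d, α.1 + β.1 = α'.1 + β'.1 → X α β = X α' β'}

/-- The pseudo-moment cone in its matrix realization, in `m` variables and degree `2d`:
the positive semidefinite generalized Hankel matrices. -/
def pseudoMomentCone (m d : ℕ) : Set (Matrix (MultiIndex m d) (MultiIndex m d) ℝ) :=
  hankel m d ∩ {X | X.PosSemidef}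

/-! ### The pseudo-moment cone is the cone of moment matrices `M(ℓ)` of the functionals dual to
sums of squares -/

open MvPolynomial in
/-- The dual of the cone of sums of squares: the linear functionals `ℓ` on real forms of degree
`2d` in `m` variables with `ℓ(q²) ≥ 0` for all forms `q` of degree `d`. -/
def sosDual (m d : ℕ) : Set (Module.Dual ℝ (homogeneousSubmodule (Fin m) ℝ (d + d))) :=
  {ℓ | ∀ q : homogeneousSubmodule (Fin m) ℝ d, 0 ≤ ℓ ⟨q.1 * q.1, q.2.mul q.2⟩}

open MvPolynomial in
/-- The matrix `M(ℓ)` with entries `ℓ(x^(α+β))`. -/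
def momentMatrix {m d : ℕ} (ℓ : Module.Dual ℝ (homogeneousSubmodule (Fin m) ℝ (d + d))) :
    Matrix (MultiIndex m d) (MultiIndex m d) ℝ :=
  fun α β => ℓ ⟨monomial (α.1 + β.1) 1,
    isHomogeneous_monomial 1 (by rw [map_add, α.2, β.2])⟩

open MvPolynomial in
theorem form_eq_sum {m d : ℕ} (q : homogeneousSubmodule (Fin m) ℝ d) :
    q.1 = ∑ α : MultiIndex m d, monomial α.1 (coeff α.1 q.1) := by
  classical
  ext γ
  rw [coeff_sum]
  simp only [coeff_monomial]
  by_cases h : γ.degree = d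
  · rw [Finset.sum_eq_single (⟨γ, h⟩ : MultiIndex m d)]
    · simp
    · rintro ⟨b, hb⟩ - hne
      rw [if_neg]
      rintro rfl
      exact hne rfl
    · simp
  · rw [Finset.sum_eq_zero]
    · exact IsHomogeneous.coeff_eq_zero q.2 h
    · rintro ⟨b, hb⟩ -
      rw [if_neg]
      rintro rfl
      exact h hb

open MvPolynomial in
theorem apply_sq {m d : ℕ} (ℓ : Module.Dual ℝ (homogeneousSubmodule (Fin m) ℝ (d + d)))
    (q : homogeneousSubmodule (Fin m) ℝ d) :
    ℓ ⟨q.1 * q.1, q.2.mul q.2⟩ =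
      ∑ α : MultiIndex m d, ∑ β : MultiIndex m d,
        coeff α.1 q.1 * momentMatrix ℓ α β * coeff β.1 q.1 := by
  have h : (⟨q.1 * q.1, q.2.mul q.2⟩ : homogeneousSubmodule (Fin m) ℝ (d + d)) =
      ∑ α : MultiIndex m d, ∑ β : MultiIndex m d, (coeff α.1 q.1 * coeff β.1 q.1) •
        (⟨monomial (α.1 + β.1) 1, isHomogeneous_monomial 1 (by rw [map_add, α.2, β.2])⟩ :
          homogeneousSubmodule (Fin m) ℝ (d + d)) := by
    apply Subtype.ext
    push_cast
    conv_lhs => rw [form_eq_sum q]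
    simp [Finset.sum_mul_sum, monomial_mul, smul_monomial]
  rw [h]
  simp only [map_sum, map_smul, momentMatrix, smul_eq_mul]
  exact Finset.sum_congr rfl fun α _ => Finset.sum_congr rfl fun β _ => by ring

theorem posSemidef_iff {m d : ℕ} (X : Matrix (MultiIndex m d) (MultiIndex m d) ℝ) :
    X.PosSemidef ↔ X.IsSymm ∧ ∀ x : MultiIndex m d → ℝ, 0 ≤ ∑ α, ∑ β, x α * X α β * x β := by
  rw [Matrix.posSemidef_iff_dotProduct_mulVec]
  refine and_congr (by rw [Matrix.IsHermitian, Matrix.conjTranspose_eq_transpose_of_trivial,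
    Matrix.IsSymm]) (forall_congr' fun x => ?_)
  simp [dotProduct, Matrix.mulVec, Finset.mul_sum, mul_assoc]

open MvPolynomial in
/-- The matrix realization of the pseudo-moment cone: the matrices `M(ℓ)`, with `ℓ` in the dual
of the cone of sums of squares, are the positive semidefinite generalized Hankel matrices. -/
theorem pseudoMomentCone_eq_image (m d : ℕ) :
    pseudoMomentCone m d = momentMatrix '' sosDual m d := by
  classical
  ext X
  constructor
  · rintro ⟨⟨-, hH⟩, hP⟩
    let y : (Fin m →₀ ℕ) → ℝ := fun γ =>
      if h : ∃ p : MultiIndex m d × MultiIndex m d, p.1.1 + p.2.1 = γ then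
        X h.choose.1 h.choose.2 else 0
    have hy : ∀ α β : MultiIndex m d, y (α.1 + β.1) = X α β := fun α β => by
      have h : ∃ p : MultiIndex m d × MultiIndex m d, p.1.1 + p.2.1 = α.1 + β.1 := ⟨(α, β), rfl⟩
      simp only [y, dif_pos h]
      exact hH _ _ _ _ h.choose_spec
    let ℓ : Module.Dual ℝ (homogeneousSubmodule (Fin m) ℝ (d + d)) :=
      ∑ γ : MultiIndex m (d + d), y γ.1 • ((lcoeff ℝ γ.1).domRestrict _)
    have hℓ : momentMatrix ℓ = X := by
      ext α β
      rw [← hy α β]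
      simp only [momentMatrix, ℓ, LinearMap.sum_apply, LinearMap.smul_apply,
        LinearMap.domRestrict_apply, lcoeff_apply, coeff_monomial, smul_eq_mul]
      rw [Finset.sum_eq_single (⟨α.1 + β.1, by rw [map_add, α.2, β.2]⟩ : MultiIndex m (d + d))]
      · simp
      · rintro ⟨b, hb⟩ - hne
        rw [if_neg, mul_zero]
        rintro rfl
        exact hne rfl
      · simp
    refine ⟨ℓ, fun q => ?_, hℓ⟩
    rw [apply_sq, hℓ]
    exact ((posSemidef_iff X).1 hP).2 _
  · rintro ⟨ℓ, hℓ, rfl⟩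
    have hH : ∀ α β α' β' : MultiIndex m d, α.1 + β.1 = α'.1 + β'.1 →
        momentMatrix ℓ α β = momentMatrix ℓ α' β' := fun α β α' β' h => by
      simp only [momentMatrix, h]
    have hS : (momentMatrix ℓ).IsSymm := Matrix.IsSymm.ext fun α β => hH _ _ _ _ (add_comm _ _)
    refine ⟨⟨hS, hH⟩, (posSemidef_iff _).2 ⟨hS, fun x => ?_⟩⟩
    let q : homogeneousSubmodule (Fin m) ℝ d :=
      ⟨∑ α : MultiIndex m d, monomial α.1 (x α),
        Submodule.sum_mem _ fun α _ => isHomogeneous_monomial _ α.2⟩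
    have hq : ∀ α : MultiIndex m d, coeff α.1 q.1 = x α := fun α => by
      simp [q, coeff_sum, coeff_monomial, ← Subtype.ext_iff]
    have := hℓ q
    rw [apply_sq] at this
    simpa only [hq] using this

/-! ### Faces and conic hulls -/

/-- A face of a convex set `C`: a convex subset `F` such that whenever a point of `F` lies in the
open segment between two points of `C`, both of these points belong to `F`. -/
def IsFace {E : Type*} [AddCommGroup E] [Module ℝ E] (C F : Set E) : Prop :=
  Convex ℝ F ∧ IsExtreme ℝ C F

/-- The minimal face of a convex set `C` containing a point `x` of `C`: the intersection of all
faces of `C` that contain `x`. -/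
def minface {E : Type*} [AddCommGroup E] [Module ℝ E] (x : E) (C : Set E) : Set E :=
  ⋂₀ {F | IsFace C F ∧ x ∈ F}

/-! ### Genericity in the Zariski topology of a real vector space -/

/-- A variety in a real vector space `V`: the set of common zeros of finitely many polynomials in
the linear coordinates of `V` (the variables of the polynomials are linear functionals). -/
def IsVariety {V : Type*} [AddCommGroup V] [Module ℝ V] (S : Set V) : Prop :=
  ∃ P : Finset (MvPolynomial (Module.Dual ℝ V) ℝ),
    S = {v | ∀ p ∈ P, MvPolynomial.eval (fun φ : Module.Dual ℝ V => φ v) p = 0}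

/-- Zariski-open sets are the complements of varieties. -/
def IsZariskiOpen {V : Type*} [AddCommGroup V] [Module ℝ V] (A : Set V) : Prop :=
  IsVariety Aᶜ

/-- A set is Zariski dense if the only variety containing it is the whole space. -/
def IsZariskiDense {V : Type*} [AddCommGroup V] [Module ℝ V] (A : Set V) : Prop :=
  ∀ S : Set V, IsVariety S → A ⊆ S → S = Set.univ

/-- A property holds generically on `V` if it holds on a Zariski-open dense subset of `V`. -/
def HoldsGenerically {V : Type*} [AddCommGroup V] [Module ℝ V] (P : V → Prop) : Prop :=
  ∃ A : Set V, IsZariskiOpen A ∧ IsZariskiDense A ∧ ∀ v ∈ A, P v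

/-- The bound `½ (C(n+d,d) + 1) - C(n+d,d)⁻¹ C(n+2d,2d)` on the number of atoms. -/
def atomBound (n d : ℕ) : ℝ :=
  1 / 2 * (((n + d).choose d : ℝ) + 1)
    - ((n + d).choose d : ℝ)⁻¹ * ((n + 2 * d).choose (2 * d) : ℝ)

end PseudoMoment

end

/-! Write `v_i = m_d(z_i)`, `N = C(n+d,d)`, `M = C(n+2d,2d)`. If a pseudo-moment matrix `Y` lies in
the minimal face of `∑ w_i² v_i v_iᵀ`, its kernel contains the common orthogonal complement of the
`v_i`, so `Y = ∑ S_ij v_i v_jᵀ` with `S` positive semidefinite. Everything reduces to showing that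
the Hankel condition forces `S` to be diagonal.

The certificate for `S_ab = 0` is a symmetric `Q` orthogonal to all Hankel matrices, with `Q v_j =
0` for `j ≠ a, b` and `v_aᵀ Q v_b ≠ 0` (`Separates`). Each `v_iᵀ Q v_i` vanishes because `v_i v_iᵀ`
is Hankel, so pairing `Q` with `Y` leaves `2 S_ab v_aᵀ Q v_b = 0`.

Symmetric matrices have `N(N+1)/2` free entries, and the linear conditions on `Q` number at most `M
+ (s-2)N`; the bound on `s` says `M + sN ≤ N(N+1)/2`, so a nonzero `Q` exists (`exists_quadric`). It
depends only on the atoms other than `a`, `b`, and moment vectors span, so `v_aᵀ Q v_b ≠ 0` for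
generic `z_a`, `z_b` (`exists_polynomial_separates`). The growth rate follows from the leading terms
of the binomials. -/

noncomputable section

namespace PseudoMoment

/-! ### Growth of the bound on the number of atoms -/

open Filter Asymptotics Topology in
theorem tendsto_choose_add_div_pow (k l : ℕ) :
    Tendsto (fun n : ℕ => ((n + k).choose l : ℝ) / (n : ℝ) ^ l) atTop (𝓝 (l.factorial : ℝ)⁻¹) := by
  have h1 : Tendsto (fun n : ℕ => ((n.choose l : ℝ)) / ((n : ℝ) ^ l / l.factorial)) atTop
      (𝓝 1) := by
    refine (isEquivalent_iff_tendsto_one ?_).1 (isEquivalent_choose l)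
    filter_upwards [eventually_gt_atTop 0] with n hn
    positivity
  have h2 := h1.comp (tendsto_add_atTop_nat k)
  have h3 : Tendsto (fun n : ℕ => (((n : ℝ) + k) / n) ^ l) atTop (𝓝 1) := by
    have h := (tendsto_natCast_div_add_atTop (k : ℝ)).inv₀ one_ne_zero
    simp only [inv_div, inv_one] at h
    simpa using h.pow l
  have h4 := (h2.mul h3).mul_const (l.factorial : ℝ)⁻¹
  rw [one_mul, one_mul] at h4
  refine h4.congr' ?_
  filter_upwards [eventually_gt_atTop 0] with n hn
  have hn' : (0 : ℝ) < n := by exact_mod_cast hn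
  have hk : (0 : ℝ) < (n : ℝ) + k := by positivity
  simp only [Function.comp, Nat.cast_add, div_pow]
  field_simp

open Filter Asymptotics Topology in
theorem tendsto_atomBound_div_pow {d : ℕ} (hd : 0 < d) :
    Tendsto (fun n : ℕ => atomBound n d / (n : ℝ) ^ d) atTop
      (𝓝 (1 / 2 * (d.factorial : ℝ)⁻¹ - d.factorial * ((2 * d).factorial : ℝ)⁻¹)) := by
  have h1 := tendsto_choose_add_div_pow d d
  have h2 := tendsto_choose_add_div_pow (2 * d) (2 * d)
  have h3 : Tendsto (fun n : ℕ => ((n : ℝ) ^ d)⁻¹) atTop (𝓝 0) :=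
    tendsto_inv_atTop_zero.comp
      ((tendsto_pow_atTop hd.ne').comp tendsto_natCast_atTop_atTop)
  have h4 := ((h1.add h3).const_mul (1 / 2)).sub ((h1.inv₀ (by positivity)).mul h2)
  rw [add_zero, inv_inv] at h4
  refine h4.congr' ?_
  filter_upwards [eventually_gt_atTop 0] with n hn
  have hn' : (0 : ℝ) < n := by exact_mod_cast hn
  have hc : (0 : ℝ) < (n + d).choose d := by exact_mod_cast Nat.choose_pos (by omega)
  rw [atomBound, two_mul d, pow_add]
  field_simp

/-- Makes the limit of `b(n,d) / n^d` positive. It amounts to `C(2d,d) > 2`, which fails for `d =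
1`. -/
theorem two_mul_factorial_sq_lt {d : ℕ} (hd : 2 ≤ d) :
    2 * (d.factorial * d.factorial) < (2 * d).factorial := by
  have h := Nat.add_choose_mul_factorial_mul_factorial d d
  have h2 : 2 < (d + d).choose d := by
    have h3 : (d + d).choose 1 ≤ (d + d).choose d := by
      rw [← two_mul, ← Nat.centralBinom_eq_two_mul_choose]
      exact Nat.choose_le_centralBinom 1 d
    rw [Nat.choose_one_right] at h3
    omega
  rw [two_mul d, ← h, mul_assoc]
  exact Nat.mul_lt_mul_of_pos_right h2 (by positivity)

open Filter Asymptotics Topology in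
theorem isTheta_atomBound {d : ℕ} (hd : 2 ≤ d) :
    (fun n : ℕ => atomBound n d) =Θ[atTop] (fun n : ℕ => (n : ℝ) ^ d) := by
  have hc : 1 / 2 * (d.factorial : ℝ)⁻¹ - d.factorial * ((2 * d).factorial : ℝ)⁻¹ ≠ 0 := by
    have h : 2 * ((d.factorial : ℝ) * d.factorial) < (2 * d).factorial := by
      exact_mod_cast two_mul_factorial_sq_lt hd
    have h1 : (0 : ℝ) < d.factorial := by positivity
    have h2 : (0 : ℝ) < (2 * d).factorial := by positivity
    refine (sub_pos.2 ?_).ne'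
    field_simp
    nlinarith
  have hd' : 0 < d := by omega
  exact (isTheta_of_div_tendsto_nhds_ne_zero (tendsto_atomBound_div_pow hd') hc).symm

/-! ### Counting multi-indices -/

theorem card_multiIndex (n d : ℕ) : Fintype.card (MultiIndex (n + 1) d) = (n + d).choose d := by
  rw [Fintype.card_of_subtype (Finset.univ.finsuppAntidiag d) (fun α => by
    simp [Finset.mem_finsuppAntidiag, Finsupp.degree_eq_sum]),
    Finset.card_finsuppAntidiag_nat_eq_choose]
  simp only [Finset.card_univ, Fintype.card_fin]
  congr 1
  omega

/-- The bound on the number of atoms leaves room for a nonzero quadric that vanishes on the Veronese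
variety and is singular at all but two of the atoms. -/
theorem card_lt_of_le_atomBound {n d s : ℕ} (hs : 2 ≤ s) (h : (s : ℝ) ≤ atomBound n d) :
    Fintype.card (MultiIndex (n + 1) (d + d)) +
      (s - 2) * Fintype.card (MultiIndex (n + 1) d) <
      (Fintype.card (MultiIndex (n + 1) d) + 1).choose 2 := by
  rw [card_multiIndex, card_multiIndex, ← two_mul d]
  have hc : 0 < (n + d).choose d := Nat.choose_pos (by omega)
  rw [atomBound] at h
  generalize (n + d).choose d = N at *
  generalize (n + 2 * d).choose (2 * d) = M at *
  have hc' : (0 : ℝ) < N := by exact_mod_cast hc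
  -- The bound on `s` multiplied by `N`. Having `s - 2` in place of `s` then gains `2N > 0`, hence
  -- the strict inequality.
  have h2 : (M : ℝ) + s * N ≤ (N + 1) * N / 2 := by
    have := mul_le_mul_of_nonneg_right h hc'.le
    field_simp at this
    nlinarith
  have h3 : (((N + 1).choose 2 : ℕ) : ℝ) = (N + 1) * N / 2 := by
    rw [Nat.cast_choose_two]
    push_cast
    ring
  rify [hs]
  rw [h3]
  nlinarith

/-! ### Quadrics vanishing on the Veronese variety with prescribed singular points -/

/-- More unknowns than linear equations. Indexing by `Sym2` builds in symmetry; the first family of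
equations kills the coefficients of the degree `2d` form that the quadric induces on the Veronese
variety. Any nontrivial commutative ring will do, so the `v j` may have indeterminate coordinates.
-/
theorem exists_quadric {R J : Type*} [CommRing R] [Nontrivial R] [Fintype J] {m d : ℕ}
    (v : J → MultiIndex m d → R)
    (h : Fintype.card (MultiIndex m (d + d)) + Fintype.card J * Fintype.card (MultiIndex m d) <
      (Fintype.card (MultiIndex m d) + 1).choose 2) :
    ∃ q : Sym2 (MultiIndex m d) → R, q ≠ 0 ∧
      (∀ γ : MultiIndex m (d + d), ∑ p : MultiIndex m d × MultiIndex m d,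
        (if p.1.1 + p.2.1 = γ.1 then q s(p.1, p.2) else 0) = 0) ∧
      ∀ j α, ∑ β, q s(α, β) * v j β = 0 := by
  classical
  let f : (Sym2 (MultiIndex m d) → R) →ₗ[R]
      (MultiIndex m (d + d) ⊕ J × MultiIndex m d → R) :=
    LinearMap.pi (Sum.elim
      (fun γ => ∑ p : MultiIndex m d × MultiIndex m d,
        if p.1.1 + p.2.1 = γ.1 then LinearMap.proj s(p.1, p.2) else 0)
      (fun x => ∑ β, v x.1 β • LinearMap.proj s(x.2, β)))
  have hf : ¬ Function.Injective f := fun hinj => by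
    have := card_le_of_injective R f hinj
    rw [Fintype.card_sum, Fintype.card_prod, ← Nat.card_eq_fintype_card (α := Sym2 _),
      Sym2.natCard, Nat.card_eq_fintype_card] at this
    omega
  rw [← LinearMap.ker_eq_bot, Submodule.eq_bot_iff] at hf
  push Not at hf
  obtain ⟨q, hq, hq0⟩ := hf
  refine ⟨q, hq0, fun γ => ?_, fun j α => ?_⟩
  · have := congr_fun hq (Sum.inl γ)
    simp only [f, LinearMap.pi_apply, Sum.elim_inl, LinearMap.sum_apply] at this
    refine (Finset.sum_congr rfl fun p _ => ?_).trans this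
    split_ifs <;> rfl
  · have := congr_fun hq (Sum.inr (j, α))
    simpa [f, mul_comm] using this

/-- On each fiber of `(α, β) ↦ α + β` the matrix `X` is constant and the entries of `Q` sum to zero.
-/
theorem sum_mul_eq_zero_of_mem_hankel {m d : ℕ}
    {Q X : Matrix (MultiIndex m d) (MultiIndex m d) ℝ}
    (hQ : ∀ γ : MultiIndex m (d + d), ∑ p : MultiIndex m d × MultiIndex m d,
        (if p.1.1 + p.2.1 = γ.1 then Q p.1 p.2 else 0) = 0)
    (hX : X ∈ hankel m d) :
    ∑ p : MultiIndex m d × MultiIndex m d, Q p.1 p.2 * X p.1 p.2 = 0 := by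
  classical
  let g : MultiIndex m d × MultiIndex m d → MultiIndex m (d + d) :=
    fun p => ⟨p.1.1 + p.2.1, by rw [map_add, p.1.2, p.2.2]⟩
  rw [← Finset.sum_fiberwise Finset.univ g]
  refine Finset.sum_eq_zero fun γ _ => ?_
  by_cases hγ : ∃ p, g p = γ
  · obtain ⟨p₀, rfl⟩ := hγ
    rw [Finset.sum_congr rfl (g := fun p => Q p.1 p.2 * X p₀.1 p₀.2), ← Finset.sum_mul,
      Finset.sum_filter]
    · have := hQ (g p₀)
      simp only [g, Subtype.ext_iff] at this ⊢
      rw [this, zero_mul]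
    · intro p hp
      rw [hX.2 p.1 p.2 p₀.1 p₀.2 (Subtype.ext_iff.1 (Finset.mem_filter.1 hp).2)]
  · rw [Finset.filter_false_of_mem fun p _ hp => hγ ⟨p, hp⟩, Finset.sum_empty]

/-! ### The moment vector over a commutative ring -/

/-- The vector of all monomials of degree at most `d` over a commutative ring. -/
def momentVecOver {R : Type*} [CommRing R] {n : ℕ} (d : ℕ) (z : Fin n → R) :
    MultiIndex (n + 1) d → R :=
  fun α => ∏ i, (Fin.cons 1 z : Fin (n + 1) → R) i ^ α.1 i

theorem momentVecOver_real {n : ℕ} (d : ℕ) (z : Fin n → ℝ) : momentVecOver d z = momentVec d z :=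
  rfl

theorem map_momentVecOver {R S : Type*} [CommRing R] [CommRing S] (f : R →+* S) {n : ℕ} (d : ℕ)
    (z : Fin n → R) (α : MultiIndex (n + 1) d) :
    f (momentVecOver d z α) = momentVecOver d (fun i => f (z i)) α := by
  simp [momentVecOver, Fin.prod_univ_succ]

open MvPolynomial in
theorem momentVecOver_X {n : ℕ} (d : ℕ) (α : MultiIndex (n + 1) d) :
    momentVecOver d (fun i => (X i : MvPolynomial (Fin n) ℝ)) α = monomial α.1.tail 1 := by
  rw [momentVecOver, Fin.prod_univ_succ, monomial_eq, Finsupp.prod_fintype _ _ (by simp)]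
  simp [Finsupp.tail_apply]

theorem tail_injective {n d : ℕ} :
    Function.Injective fun α : MultiIndex (n + 1) d => α.1.tail := by
  intro α β h
  have h' : α.1.tail = β.1.tail := h
  have hα := α.2
  have hβ := β.2
  rw [Finsupp.degree_eq_sum, Fin.sum_univ_succ] at hα hβ
  have ht : ∀ i : Fin n, α.1 i.succ = β.1 i.succ := fun i => DFunLike.congr_fun h' i
  rw [Finset.sum_congr rfl fun i _ => ht i] at hα
  refine Subtype.ext (Finsupp.ext fun i => ?_)
  refine Fin.cases ?_ ht i
  omega

open MvPolynomial in
/-- The moment vectors span the whole space. -/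
theorem eq_zero_of_forall_dotProduct_momentVec {n d : ℕ} {c : MultiIndex (n + 1) d → ℝ}
    (h : ∀ z : Fin n → ℝ, c ⬝ᵥ momentVec d z = 0) : c = 0 := by
  -- As a function of `z`, the pairing is the polynomial with coefficients `c`; distinct
  -- multi-indices dehomogenize to distinct monomials.
  have hp : ∑ α : MultiIndex (n + 1) d, monomial α.1.tail (c α) = 0 := by
    refine MvPolynomial.funext fun z => ?_
    rw [map_sum, map_zero, ← h z]
    refine Finset.sum_congr rfl fun α _ => ?_
    have := map_momentVecOver (eval z) d X α
    rw [momentVecOver_X] at this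
    simp only [eval_X] at this
    rw [← momentVecOver_real, ← this, eval_monomial, eval_monomial, one_mul]
  ext α
  have := congr_arg (coeff α.1.tail) hp
  rw [coeff_sum, Finset.sum_eq_single α] at this
  · simpa using this
  · intro β _ hβ
    rw [coeff_monomial, if_neg fun h => hβ (tail_injective h)]
  · simp

/-! ### Separating two atoms by a quadric -/

/-- `Q` separates the atoms `a` and `b`: it is a quadric that vanishes on the Veronese variety and
is singular at all other atoms, but does not pair `a` and `b` to zero. -/
structure Separates {n s : ℕ} (d : ℕ) (z : Fin s → Fin n → ℝ) (a b : Fin s)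
    (Q : Matrix (MultiIndex (n + 1) d) (MultiIndex (n + 1) d) ℝ) : Prop where
  isSymm : Q.IsSymm
  sum_mul_eq_zero : ∀ X ∈ hankel (n + 1) d,
    ∑ p : MultiIndex (n + 1) d × MultiIndex (n + 1) d, Q p.1 p.2 * X p.1 p.2 = 0
  mulVec_eq_zero : ∀ j, j ≠ a → j ≠ b → Q.mulVec (momentVec d (z j)) = 0
  pairing_ne_zero : momentVec d (z a) ⬝ᵥ Q.mulVec (momentVec d (z b)) ≠ 0

-- The quadric is found over the polynomial ring in the coordinates of the atoms other than `a`,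
-- `b`; `p` is its pairing of the generic moment vectors at `a` and `b`.
open MvPolynomial in
theorem exists_polynomial_separates {n d s : ℕ} {a b : Fin s} (hab : a ≠ b)
    (h : Fintype.card (MultiIndex (n + 1) (d + d)) +
      (s - 2) * Fintype.card (MultiIndex (n + 1) d) <
      (Fintype.card (MultiIndex (n + 1) d) + 1).choose 2) :
    ∃ p : MvPolynomial (Fin s × Fin n) ℝ, p ≠ 0 ∧ ∀ z : Fin s → Fin n → ℝ,
      eval (fun x => z x.1 x.2) p ≠ 0 → ∃ Q, Separates d z a b Q := by
  classical
  let J := {j : Fin s // j ∉ ({a, b} : Finset (Fin s))}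
  have hJ : Fintype.card J = s - 2 := by
    rw [Fintype.card_subtype, Finset.filter_notMem_eq_sdiff,
      Finset.card_sdiff_of_subset (Finset.subset_univ _), Finset.card_univ, Fintype.card_fin,
      Finset.card_pair hab]
  rw [← hJ] at h
  obtain ⟨q, hq0, hq1, hq2⟩ := exists_quadric (R := MvPolynomial (J × Fin n) ℝ)
    (fun j => momentVecOver d fun i => X (j, i)) h
  let Q : (J → Fin n → ℝ) → Matrix (MultiIndex (n + 1) d) (MultiIndex (n + 1) d) ℝ :=
    fun y α β => eval (fun x => y x.1 x.2) (q s(α, β))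
  let p : MvPolynomial (Fin s × Fin n) ℝ := ∑ α, ∑ β,
    momentVecOver d (fun i => X (a, i)) α *
      (rename (Prod.map Subtype.val id) (q s(α, β)) * momentVecOver d (fun i => X (b, i)) β)
  have hp : ∀ z : Fin s → Fin n → ℝ, eval (fun x => z x.1 x.2) p =
      momentVec d (z a) ⬝ᵥ (Q fun j => z j.1).mulVec (momentVec d (z b)) := fun z => by
    simp only [p, map_sum, map_mul, map_momentVecOver, eval_X, eval_rename, dotProduct,
      Matrix.mulVec, Finset.mul_sum, momentVecOver_real, Q]
    rfl
  refine ⟨p, fun hp0 => hq0 ?_, fun z hz => ⟨Q fun j => z j.1, ?_, ?_, ?_, ?_⟩⟩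
  -- If `p = 0`, fix the other atoms at `y`: `Q y` is unaffected by the atoms `a` and `b`, which
  -- range freely, and spanning forces `Q y = 0`.
  · have hQ : ∀ y, Q y = 0 := fun y => by
      have hy : ∀ za zb : Fin n → ℝ,
          momentVec d za ⬝ᵥ (Q y).mulVec (momentVec d zb) = 0 := fun za zb => by
        let z : Fin s → Fin n → ℝ := fun j =>
          if hj : j ∉ ({a, b} : Finset (Fin s)) then y ⟨j, hj⟩ else if j = a then za else zb
        have h1 : (fun j : J => z j.1) = y := funext fun j => dif_pos j.2
        have h2 : z a = za := by simp [z]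
        have h3 : z b = zb := by simp [z, hab.symm]
        have := hp z
        rw [h1, h2, h3, hp0, map_zero] at this
        exact this.symm
      ext α β
      refine congr_fun (eq_zero_of_forall_dotProduct_momentVec (c := Q y α) fun zb => ?_) β
      refine congr_fun (eq_zero_of_forall_dotProduct_momentVec
        (c := (Q y).mulVec (momentVec d zb)) fun za => ?_) α
      rw [dotProduct_comm, hy]
    funext e
    induction e with
    | _ α β =>
      refine MvPolynomial.funext fun x => ?_
      rw [Pi.zero_apply, map_zero]
      exact congr_fun (congr_fun (hQ fun j i => x (j, i)) α) β
  · refine Matrix.IsSymm.ext fun α β => ?_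
    simp only [Q, Sym2.eq_swap]
  · refine fun Y hY => sum_mul_eq_zero_of_mem_hankel (fun γ => ?_) hY
    have := congr_arg (eval fun x : J × Fin n => z x.1 x.2) (hq1 γ)
    rw [map_sum, map_zero] at this
    refine (Finset.sum_congr rfl fun p _ => ?_).trans this
    rw [apply_ite (eval _), map_zero]
  · intro j hja hjb
    ext α
    have := congr_arg (eval fun x : J × Fin n => z x.1 x.2) (hq2 ⟨j, by simp [hja, hjb]⟩ α)
    simp only [map_sum, map_mul, map_momentVecOver, eval_X, map_zero] at this
    exact this
  · rwa [← hp]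

/-! ### Consequences of separation -/

section Separation

variable {n d s : ℕ} {z : Fin s → Fin n → ℝ}

theorem atomMatrix_mem_pseudoMomentCone (d : ℕ) (y : Fin n → ℝ) :
    atomMatrix d y ∈ pseudoMomentCone (n + 1) d := by
  have hS : (atomMatrix d y).IsSymm := Matrix.IsSymm.ext fun α β => by
    simp only [atomMatrix, Matrix.vecMulVec_apply, mul_comm]
  refine ⟨⟨hS, fun α β α' β' h => ?_⟩, ?_⟩
  · simp only [atomMatrix, Matrix.vecMulVec_apply, momentVec, monomialVec,
      ← Finset.prod_mul_distrib, ← pow_add]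
    exact Finset.prod_congr rfl fun i _ => by rw [← Finsupp.add_apply, h, Finsupp.add_apply]
  · simpa [atomMatrix] using Matrix.posSemidef_vecMulVec_self_star (momentVec d y)

theorem sum_mul_vecMulVec {ι : Type*} [Fintype ι] (Q : Matrix ι ι ℝ) (x y : ι → ℝ) :
    ∑ p : ι × ι, Q p.1 p.2 * Matrix.vecMulVec x y p.1 p.2 = x ⬝ᵥ Q.mulVec y := by
  rw [Fintype.sum_prod_type]
  simp only [Matrix.vecMulVec_apply, dotProduct, Matrix.mulVec, Finset.mul_sum]
  exact Finset.sum_congr rfl fun α _ => Finset.sum_congr rfl fun β _ => by ring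

theorem Separates.pairing_eq_zero {a b : Fin s}
    {Q : Matrix (MultiIndex (n + 1) d) (MultiIndex (n + 1) d) ℝ} (hQ : Separates d z a b Q)
    {i j : Fin s} (h : s(i, j) ≠ s(a, b)) :
    momentVec d (z i) ⬝ᵥ Q.mulVec (momentVec d (z j)) = 0 := by
  by_cases hij : i = j
  · subst hij
    have := hQ.sum_mul_eq_zero _ (atomMatrix_mem_pseudoMomentCone d (z i)).1
    rwa [atomMatrix, sum_mul_vecMulVec] at this
  by_cases hj : j ≠ a ∧ j ≠ b
  · rw [hQ.mulVec_eq_zero j hj.1 hj.2, dotProduct_zero]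
  have hi : i ≠ a ∧ i ≠ b := by
    rw [Ne, Sym2.eq_iff] at h
    grind
  rw [Matrix.dotProduct_mulVec, ← Matrix.mulVec_transpose, hQ.isSymm.eq,
    hQ.mulVec_eq_zero i hi.1 hi.2, zero_dotProduct]

/-- Pairing a linear relation with `v_b` through a separating `Q` isolates the coefficient of `v_a`.
-/
theorem linearIndependent_momentVec
    (hz : ∀ a b : Fin s, a ≠ b → ∃ Q, Separates d z a b Q) :
    LinearIndependent ℝ fun i => momentVec d (z i) := by
  rw [Fintype.linearIndependent_iff]
  intro c hc a
  by_cases ha : ∃ b, a ≠ b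
  · obtain ⟨b, hab⟩ := ha
    obtain ⟨Q, hQ⟩ := hz b a hab.symm
    have h := congr_arg (fun x => momentVec d (z b) ⬝ᵥ Q.mulVec x) hc
    simp only [Matrix.mulVec_sum, Matrix.mulVec_smul, dotProduct_sum, dotProduct_smul,
      Matrix.mulVec_zero, dotProduct_zero] at h
    rw [Finset.sum_eq_single a (fun j _ hj => ?_) (by simp)] at h
    · exact (smul_eq_zero.1 h).resolve_right hQ.pairing_ne_zero
    · rw [hQ.pairing_eq_zero, smul_zero]
      rw [Ne, Sym2.eq_iff]
      grind
  · push Not at ha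
    -- With a single atom, use the coordinate of the constant monomial, which equals `1`.
    have h := congr_fun hc ⟨Finsupp.single 0 d, by simp⟩
    rw [Finset.sum_apply, Finset.sum_eq_single a (fun j _ hj => absurd (ha j).symm hj)
      (by simp)] at h
    simpa [momentVec, monomialVec, Fin.prod_univ_succ] using h

theorem linearIndependent_vecMulVec_self {ι κ : Type*} [Fintype ι] {v : κ → ι → ℝ}
    (hv : LinearIndependent ℝ v) : LinearIndependent ℝ fun i => Matrix.vecMulVec (v i) (v i) := by
  rw [linearIndependent_iff'] at hv ⊢
  intro t c hc i hi
  -- Each row of the matrix relation is a relation among the `v j`.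
  have h : ∀ α, c i * v i α = 0 := fun α => by
    refine hv t (fun j => c j * v j α) (funext fun β => ?_) i hi
    have := congr_fun (congr_fun hc α) β
    simpa [Finset.sum_apply, Matrix.sum_apply, Matrix.vecMulVec_apply, mul_assoc] using this
  by_contra hc0
  have hvi : v i = 0 := funext fun α => (mul_eq_zero.1 (h α)).resolve_left hc0
  classical
  refine one_ne_zero (α := ℝ) ?_
  have := hv t (Pi.single i 1) ?_ i hi
  · simp at this
  · rw [Finset.sum_eq_single i (fun j _ hj => by simp [hj]) (by simp [hi]), hvi, smul_zero]

/-- A Hankel matrix that is a combination of products of separated moment vectors has no mixed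
terms. -/
theorem eq_zero_of_mem_hankel (hz : ∀ a b : Fin s, a ≠ b → ∃ Q, Separates d z a b Q)
    {S : Matrix (Fin s) (Fin s) ℝ} (hS : S.IsSymm)
    (h : ∑ i, ∑ j, S i j • Matrix.vecMulVec (momentVec d (z i)) (momentVec d (z j)) ∈
      hankel (n + 1) d) {a b : Fin s} (hab : a ≠ b) : S a b = 0 := by
  obtain ⟨Q, hQ⟩ := hz a b hab
  have h1 := hQ.sum_mul_eq_zero _ h
  have h2 : ∑ x : Fin s × Fin s, S x.1 x.2 *
      (momentVec d (z x.1) ⬝ᵥ Q.mulVec (momentVec d (z x.2))) = 0 := by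
    rw [← h1, Fintype.sum_prod_type]
    simp only [Matrix.sum_apply, Matrix.smul_apply, Finset.mul_sum, smul_eq_mul,
      ← sum_mul_vecMulVec]
    rw [Finset.sum_comm (s := Finset.univ (α := MultiIndex (n + 1) d × MultiIndex (n + 1) d))]
    refine Finset.sum_congr rfl fun i _ => ?_
    rw [Finset.sum_comm (s := Finset.univ (α := MultiIndex (n + 1) d × MultiIndex (n + 1) d))]
    exact Finset.sum_congr rfl fun j _ => Finset.sum_congr rfl fun p _ => by ring
  have hba : momentVec d (z b) ⬝ᵥ Q.mulVec (momentVec d (z a)) =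
      momentVec d (z a) ⬝ᵥ Q.mulVec (momentVec d (z b)) := by
    rw [Matrix.dotProduct_mulVec, ← Matrix.mulVec_transpose, hQ.isSymm.eq, dotProduct_comm]
  have h3 : (a, b) ≠ (b, a) := fun h => hab (Prod.ext_iff.1 h).1
  rw [Fintype.sum_eq_add (a, b) (b, a) h3 fun x hx => ?_] at h2
  · simp only [hba, hS.apply a b] at h2
    rw [← two_mul] at h2
    exact (mul_eq_zero.1 ((mul_eq_zero.1 h2).resolve_left two_ne_zero)).resolve_right
      hQ.pairing_ne_zero
  · rw [hQ.pairing_eq_zero, mul_zero]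
    rw [Ne, Sym2.eq_iff]
    grind

end Separation

/-! ### Faces of the pseudo-moment cone -/

section Faces

variable {n d s : ℕ} {z : Fin s → Fin n → ℝ}

theorem mem_hull_range_iff {E κ : Type*} [AddCommGroup E] [Module ℝ E] [Fintype κ] {A : κ → E}
    {x : E} : x ∈ PointedCone.hull ℝ (Set.range A) ↔
      ∃ c : κ → ℝ, (∀ i, 0 ≤ c i) ∧ ∑ i, c i • A i = x := by
  rw [PointedCone.hull, Submodule.mem_span_range_iff_exists_fun]
  constructor
  · rintro ⟨c, rfl⟩
    exact ⟨fun i => c i, fun i => (c i).2, rfl⟩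
  · rintro ⟨c, hc, rfl⟩
    exact ⟨fun i => ⟨c i, hc i⟩, rfl⟩

theorem sum_smul_mem_pseudoMomentCone {κ : Type*} [Fintype κ] (d : ℕ) (y : κ → Fin n → ℝ)
    {c : κ → ℝ} (hc : ∀ i, 0 ≤ c i) :
    ∑ i, c i • atomMatrix d (y i) ∈ pseudoMomentCone (n + 1) d := by
  have h := fun i => atomMatrix_mem_pseudoMomentCone d (y i)
  refine ⟨⟨?_, fun α β α' β' hαβ => ?_⟩, ?_⟩
  · rw [Matrix.IsSymm, Matrix.transpose_sum]
    exact Finset.sum_congr rfl fun i _ => by rw [Matrix.transpose_smul, (h i).1.1.eq]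
  · simp only [Matrix.sum_apply, Matrix.smul_apply]
    exact Finset.sum_congr rfl fun i _ => by rw [(h i).1.2 α β α' β' hαβ]
  · exact Matrix.posSemidef_sum _ fun i _ => (h i).2.smul (hc i)

/-- A positive semidefinite matrix whose kernel contains the orthogonal complement of linearly
independent vectors is a positive semidefinite combination of their products. -/
theorem exists_posSemidef_eq_sum {ι κ : Type*} [Fintype ι] [Fintype κ] {v : κ → ι → ℝ}
    (hv : LinearIndependent ℝ v) {Y : Matrix ι ι ℝ} (hY : Y.PosSemidef)
    (hker : ∀ u : ι → ℝ, (∀ i, v i ⬝ᵥ u = 0) → Y.mulVec u = 0) :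
    ∃ S : Matrix κ κ ℝ, S.PosSemidef ∧ Y = ∑ i, ∑ j, S i j • Matrix.vecMulVec (v i) (v j) := by
  classical
  let W : Matrix κ ι ℝ := Matrix.of v
  obtain ⟨L, hL⟩ : ∃ L : Matrix ι κ ℝ, W * L = 1 := by
    rw [← Matrix.mulVec_surjective_iff_exists_right_inverse]
    have h : LinearMap.range W.mulVecLin = ⊤ := Submodule.eq_top_of_finrank_eq ?_
    · exact LinearMap.range_eq_top.1 h
    rw [Module.finrank_fintype_fun_eq_card]
    exact LinearIndependent.rank_matrix (M := W) hv
  have hYt : Y.transpose = Y := by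
    have := hY.isHermitian
    rwa [Matrix.IsHermitian, Matrix.conjTranspose_eq_transpose_of_trivial] at this
  have h1 : Y = Y * L * W := by
    -- The columns of `1 - L * W` are orthogonal to every `v i`.
    have h : Y * ((1 : Matrix ι ι ℝ) - L * W) = 0 := by
      have hW : W * ((1 : Matrix ι ι ℝ) - L * W) = 0 := by
        rw [Matrix.mul_sub, Matrix.mul_one, ← Matrix.mul_assoc, hL, Matrix.one_mul, sub_self]
      ext α β
      refine congr_fun (hker (fun γ => ((1 : Matrix ι ι ℝ) - L * W) γ β) fun i => ?_) α
      exact congr_fun (congr_fun hW i) β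
    rw [Matrix.mul_sub, Matrix.mul_one, sub_eq_zero, ← Matrix.mul_assoc] at h
    exact h
  have h2 : Y = W.transpose * (L.transpose * Y * L) * W := by
    have h3 : Y = W.transpose * L.transpose * Y := by
      conv_lhs => rw [← hYt, h1]
      rw [Matrix.transpose_mul, Matrix.transpose_mul, hYt, Matrix.mul_assoc]
    conv_lhs => rw [h1, h3]
    simp only [Matrix.mul_assoc]
  refine ⟨L.transpose * Y * L, ?_, ?_⟩
  · have := hY.conjTranspose_mul_mul_same L
    rwa [Matrix.conjTranspose_eq_transpose_of_trivial] at this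
  · generalize L.transpose * Y * L = S at h2
    rw [h2]
    ext α β
    simp only [Matrix.mul_apply, Matrix.transpose_apply, Matrix.sum_apply, Matrix.smul_apply,
      Matrix.vecMulVec_apply, Finset.sum_mul, W, Matrix.of_apply, smul_eq_mul]
    rw [Finset.sum_comm]
    exact Finset.sum_congr rfl fun i _ => Finset.sum_congr rfl fun j _ => by ring

/-- A pseudo-moment matrix whose kernel contains the orthogonal complement of separated moment
vectors lies in the conic hull of their rank-one matrices. -/
theorem mem_hull_of_ker_le (hz : ∀ a b : Fin s, a ≠ b → ∃ Q, Separates d z a b Q)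
    {Y : Matrix (MultiIndex (n + 1) d) (MultiIndex (n + 1) d) ℝ}
    (hY : Y ∈ pseudoMomentCone (n + 1) d)
    (hker : ∀ u, (∀ i, momentVec d (z i) ⬝ᵥ u = 0) → Y.mulVec u = 0) :
    Y ∈ PointedCone.hull ℝ (Set.range fun i => atomMatrix d (z i)) := by
  obtain ⟨S, hS, rfl⟩ := exists_posSemidef_eq_sum (linearIndependent_momentVec hz) hY.2 hker
  have hSs : S.IsSymm := by
    have := hS.isHermitian
    rwa [Matrix.IsHermitian, Matrix.conjTranspose_eq_transpose_of_trivial] at this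
  refine mem_hull_range_iff.2 ⟨fun i => S i i, fun i => hS.diag_nonneg, ?_⟩
  refine Finset.sum_congr rfl fun i _ => ?_
  rw [Finset.sum_eq_single i (fun j _ hj => ?_) (by simp)]
  · rfl
  · rw [eq_zero_of_mem_hankel hz hSs hY.1 hj.symm, zero_smul]

/-- If `u` is orthogonal to all `v_i`, the quadratic form of a point of the hull vanishes at `u`;
for positive semidefinite endpoints of a segment through it, `u` must then lie in both kernels. -/
theorem isFace_hull (hz : ∀ a b : Fin s, a ≠ b → ∃ Q, Separates d z a b Q) :
    IsFace (pseudoMomentCone (n + 1) d)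
      (PointedCone.hull ℝ (Set.range fun i => atomMatrix d (z i)) :
        Set (Matrix (MultiIndex (n + 1) d) (MultiIndex (n + 1) d) ℝ)) := by
  refine ⟨PointedCone.convex _, fun x hx => ?_, fun Y₁ h₁ Y₂ h₂ x hx hxo => ?_⟩
  · obtain ⟨c, hc, rfl⟩ := mem_hull_range_iff.1 hx
    exact sum_smul_mem_pseudoMomentCone d z hc
  · obtain ⟨c, -, rfl⟩ := mem_hull_range_iff.1 hx
    obtain ⟨t₁, t₂, ht₁, ht₂, -, hx⟩ := hxo
    refine mem_hull_of_ker_le hz h₁ fun u hu => ?_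
    have h0 : u ⬝ᵥ (∑ i, c i • atomMatrix d (z i)).mulVec u = 0 := by
      rw [Matrix.sum_mulVec, dotProduct_sum]
      refine Finset.sum_eq_zero fun i _ => ?_
      rw [Matrix.smul_mulVec, atomMatrix, Matrix.vecMulVec_mulVec, hu i]
      simp
    rw [← hx, Matrix.add_mulVec, dotProduct_add, Matrix.smul_mulVec, Matrix.smul_mulVec,
      dotProduct_smul, dotProduct_smul, smul_eq_mul, smul_eq_mul] at h0
    have hn₁ := h₁.2.dotProduct_mulVec_nonneg u
    have hn₂ := h₂.2.dotProduct_mulVec_nonneg u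
    rw [star_trivial] at hn₁ hn₂
    refine (h₁.2.dotProduct_mulVec_zero_iff u).1 ?_
    rw [star_trivial]
    nlinarith [mul_nonneg ht₁.le hn₁, mul_nonneg ht₂.le hn₂]

theorem minface_eq_hull (hz : ∀ a b : Fin s, a ≠ b → ∃ Q, Separates d z a b Q) {w : Fin s → ℝ}
    (hw : ∀ i, w i ≠ 0) :
    minface (∑ i, w i ^ 2 • atomMatrix d (z i)) (pseudoMomentCone (n + 1) d) =
      (PointedCone.hull ℝ (Set.range fun i => atomMatrix d (z i)) :
        Set (Matrix (MultiIndex (n + 1) d) (MultiIndex (n + 1) d) ℝ)) := by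
  refine Set.Subset.antisymm (Set.sInter_subset_of_mem ⟨isFace_hull hz,
    mem_hull_range_iff.2 ⟨fun i => w i ^ 2, fun i => sq_nonneg _, rfl⟩⟩) ?_
  rintro Y hY F ⟨hF, hxF⟩
  obtain ⟨c, hc, rfl⟩ := mem_hull_range_iff.1 hY
  -- All weights `w i ^ 2` are positive, so a small multiple of `Y` can be subtracted within the
  -- hull, which puts the given point in an open segment starting at `Y`.
  obtain ⟨t, ht0, ht1, ht⟩ : ∃ t : ℝ, 0 < t ∧ t < 1 ∧ ∀ i, t * c i ≤ w i ^ 2 := by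
    have h : ∀ i, ∀ᶠ t : ℝ in nhdsWithin 0 (Set.Ioi 0), t * c i ≤ w i ^ 2 := fun i => by
      have h1 : Filter.Tendsto (fun t : ℝ => t * c i) (nhdsWithin 0 (Set.Ioi 0)) (nhds 0) := by
        have : Continuous fun t : ℝ => t * c i := by fun_prop
        simpa using (this.tendsto 0).mono_left nhdsWithin_le_nhds
      exact h1.eventually_le_const (by have := hw i; positivity)
    have h2 : ∀ᶠ t : ℝ in nhdsWithin 0 (Set.Ioi 0), t ∈ Set.Ioo (0 : ℝ) 1 :=
      Ioo_mem_nhdsGT one_pos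
    obtain ⟨t, ht, ht'⟩ := (h2.and (Filter.eventually_all.2 h)).exists
    exact ⟨t, ht.1, ht.2, ht'⟩
  have h1t : 0 < 1 - t := sub_pos.2 ht1
  refine hF.2.left_mem_of_mem_openSegment (sum_smul_mem_pseudoMomentCone d z hc)
    (sum_smul_mem_pseudoMomentCone d z (c := fun i => (1 - t)⁻¹ * (w i ^ 2 - t * c i))
      fun i => mul_nonneg (by positivity) (sub_nonneg.2 (ht i))) hxF
    ⟨t, 1 - t, ht0, h1t, by ring, ?_⟩
  rw [Finset.smul_sum, Finset.smul_sum, ← Finset.sum_add_distrib]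
  refine Finset.sum_congr rfl fun i _ => ?_
  rw [smul_smul, smul_smul, ← add_smul]
  congr 1
  field_simp
  ring

end Faces

/-! ### Genericity -/

section Genericity

variable {V : Type*} [AddCommGroup V] [Module ℝ V]

open MvPolynomial in
/-- The restriction of a polynomial in the linear coordinates to the line through two points. -/
def lineRestriction (v v₀ : V) : MvPolynomial (Module.Dual ℝ V) ℝ →+* Polynomial ℝ :=
  eval₂Hom Polynomial.C fun φ => Polynomial.C (φ v) + Polynomial.X * Polynomial.C (φ (v₀ - v))

open MvPolynomial in
theorem eval_lineRestriction (v v₀ : V) (p : MvPolynomial (Module.Dual ℝ V) ℝ) (t : ℝ) :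
    (lineRestriction v v₀ p).eval t =
      eval (fun φ : Module.Dual ℝ V => φ (v + t • (v₀ - v))) p := by
  induction p using MvPolynomial.induction_on with
  | C a => simp [lineRestriction]
  | add p q hp hq => rw [map_add, Polynomial.eval_add, hp, hq, map_add]
  | mul_X p φ hp =>
    rw [map_mul, Polynomial.eval_mul, hp, map_mul, eval_X]
    congr 1
    simp [lineRestriction]

open MvPolynomial in
/-- A property that holds where a given polynomial does not vanish holds generically, provided that
this polynomial is somewhere nonzero. -/
theorem holdsGenerically_of_eval_ne_zero {P : V → Prop} (p : MvPolynomial (Module.Dual ℝ V) ℝ)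
    {v₀ : V} (h₀ : eval (fun φ : Module.Dual ℝ V => φ v₀) p ≠ 0)
    (hP : ∀ v, eval (fun φ : Module.Dual ℝ V => φ v) p ≠ 0 → P v) : HoldsGenerically P := by
  refine ⟨{v | eval (fun φ : Module.Dual ℝ V => φ v) p ≠ 0}, ⟨{p}, ?_⟩, ?_, hP⟩
  · ext v
    simp
  · rintro S ⟨T, rfl⟩ hA
    refine Set.eq_univ_of_forall fun v q hq => ?_
    -- On the line from `v` to `v₀`, `p * q` vanishes identically and `p` does not, so `q` does, in
    -- particular at `v`. Nonvanishing at `v₀` is needed because the variables, being functionals,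
    -- satisfy linear relations.
    have hp0 : lineRestriction v v₀ p ≠ 0 := fun h => h₀ <| by
      have := eval_lineRestriction v v₀ p 1
      rw [h, one_smul, add_sub_cancel, Polynomial.eval_zero] at this
      exact this.symm
    have hpq : lineRestriction v v₀ p * lineRestriction v v₀ q = 0 := by
      refine Polynomial.funext fun t => ?_
      rw [Polynomial.eval_mul, Polynomial.eval_zero, eval_lineRestriction, eval_lineRestriction,
        mul_eq_zero, or_iff_not_imp_left]
      exact fun h => hA h q hq
    have := eval_lineRestriction v v₀ q 0
    rw [(mul_eq_zero.1 hpq).resolve_left hp0, zero_smul, add_zero, Polynomial.eval_zero] at this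
    exact this.symm

end Genericity

open MvPolynomial in
theorem holdsGenerically_separates {n d s : ℕ} (hs : (s : ℝ) ≤ atomBound n d) :
    HoldsGenerically (V := Fin s → ℝ × (Fin n → ℝ)) fun wz =>
      (∀ i, (wz i).1 ≠ 0) ∧
        ∀ a b : Fin s, a ≠ b → ∃ Q, Separates d (fun i => (wz i).2) a b Q := by
  have hp : ∀ x : Fin s × Fin s, ∃ p : MvPolynomial (Fin s × Fin n) ℝ, p ≠ 0 ∧
      (x.1 ≠ x.2 → ∀ z : Fin s → Fin n → ℝ, eval (fun x => z x.1 x.2) p ≠ 0 →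
        ∃ Q, Separates d z x.1 x.2 Q) := fun x => by
    by_cases hx : x.1 = x.2
    -- Diagonal pairs get the harmless factor `1`, so that the product can run over all pairs.
    · exact ⟨1, one_ne_zero, fun h => absurd hx h⟩
    · obtain ⟨p, hp, h⟩ := exists_polynomial_separates hx
        (card_lt_of_le_atomBound (by have := x.1.2; have := x.2.2; omega) hs)
      exact ⟨p, hp, fun _ => h⟩
  choose p hp0 hp using hp
  let weight (i : Fin s) : Module.Dual ℝ (Fin s → ℝ × (Fin n → ℝ)) :=
    LinearMap.fst ℝ ℝ (Fin n → ℝ) ∘ₗ LinearMap.proj i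
  let coord (x : Fin s × Fin n) : Module.Dual ℝ (Fin s → ℝ × (Fin n → ℝ)) :=
    LinearMap.proj x.2 ∘ₗ LinearMap.snd ℝ ℝ (Fin n → ℝ) ∘ₗ LinearMap.proj x.1
  let P : MvPolynomial (Module.Dual ℝ (Fin s → ℝ × (Fin n → ℝ))) ℝ :=
    (∏ i, X (weight i)) * rename coord (∏ x, p x)
  have hP : ∀ wz : Fin s → ℝ × (Fin n → ℝ), eval (fun φ => φ wz) P =
      (∏ i, (wz i).1) * ∏ x, eval (fun x : Fin s × Fin n => (wz x.1).2 x.2) (p x) := fun wz => by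
    simp only [P, map_mul, map_prod, eval_X, eval_rename]
    rfl
  obtain ⟨y, hy⟩ : ∃ y : Fin s × Fin n → ℝ, eval y (∏ x, p x) ≠ 0 := by
    by_contra! h
    exact Finset.prod_ne_zero_iff.2 (fun x _ => hp0 x)
      (MvPolynomial.funext fun y => (h y).trans (map_zero _).symm)
  refine holdsGenerically_of_eval_ne_zero P (v₀ := fun i => (1, fun k => y (i, k))) ?_
    fun wz hwz => ?_
  · rw [hP]
    simpa [map_prod] using hy
  · rw [hP, mul_ne_zero_iff, Finset.prod_ne_zero_iff, Finset.prod_ne_zero_iff] at hwz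
    exact ⟨fun i => hwz.1 i (Finset.mem_univ _), fun a b hab =>
      hp (a, b) hab _ (hwz.2 (a, b) (Finset.mem_univ _))⟩

end PseudoMoment

end

theorem theorem1 :
    (∀ (n d s : ℕ), 0 < n → 0 < d → 0 < s → (s : ℝ) ≤ PseudoMoment.atomBound n d →
      PseudoMoment.HoldsGenerically (V := Fin s → ℝ × (Fin n → ℝ)) (fun wz =>
        PseudoMoment.minface
            (∑ i, (wz i).1 ^ 2 • PseudoMoment.atomMatrix d (wz i).2)
            (PseudoMoment.pseudoMomentCone (n + 1) d)
          = (PointedCone.hull ℝ (Set.range fun i => PseudoMoment.atomMatrix d (wz i).2) :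
              Set (Matrix (PseudoMoment.MultiIndex (n + 1) d)
                (PseudoMoment.MultiIndex (n + 1) d) ℝ)) ∧
        LinearIndependent ℝ (fun i => PseudoMoment.atomMatrix d (wz i).2))) ∧
    (∀ d : ℕ, 2 ≤ d →
      (fun n : ℕ => PseudoMoment.atomBound n d) =Θ[Filter.atTop] (fun n : ℕ => (n : ℝ) ^ d)) := by
  refine ⟨fun n d s _ _ _ hs => ?_, fun d hd => PseudoMoment.isTheta_atomBound hd⟩
  obtain ⟨A, hA, hA', h⟩ := PseudoMoment.holdsGenerically_separates hs
  exact ⟨A, hA, hA', fun wz hwz => ⟨PseudoMoment.minface_eq_hull (h wz hwz).2 (h wz hwz).1,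
    PseudoMoment.linearIndependent_vecMulVec_self
      (PseudoMoment.linearIndependent_momentVec (h wz hwz).2)⟩⟩
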